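/- Let $\mathbb{F}_q$ be a finite field, $\sigma:\mathbb{F}_q\to\mathbb{F}_q$ a ring endomorphism (necessarily an automorphism) and $\delta:\mathbb{F}_q\to\mathbb{F}_q$ a $\sigma$-derivation, i.e. an additive map with $\delta(ab)=\sigma(a)\delta(b)+\delta(a)b$. For a division ring $\mathbb{F}$ with a ring endomorphism $\sigma$ and a $\sigma$-derivation $\delta$, let $\mathbb{F}[x;\sigma,\delta]$ be the ring of polynomials $\sum_i a_ix^i$ with the usual addition and the multiplication determined by $xa=\sigma(a)x+\delta(a)$. A ring $\tilde{\mathbb{F}}[x;\tilde\sigma,\tilde\delta]$, with $\tilde{\mathbb{F}}$ a division ring, $\tilde\sigma$ a ring endomorphism of $\tilde{\mathbb{F}}$ and $\tilde\delta$ a $\tilde\sigma$-derivation, is a polynomial ring extension of $\mathbb{F}_q[x;\sigma,\delta]$ if $\mathbb{F}_q$ is a subring of $\tilde{\mathbb{F}}$, $\tilde\sigma|_{\mathbb{F}_q}=\sigma$ and $\tilde\delta|_{\mathbb{F}_q}=\delta$. If moreover $\tilde\sigma$ is an automorphism, then $a\in\tilde{\mathbb{F}}$ is a left root of $f\in\tilde{\mathbb{F}}[x;\tilde\sigma,\tilde\delta]$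 if the remainder of the left division of $f$ by $x-a$ is zero, i.e. $f=(x-a)h$ for some $h\in\tilde{\mathbb{F}}[x;\tilde\sigma,\tilde\delta]$. For $t,r\ge 0$ let $\mathcal{T}_{t,r}(a)$ be the sum of all compositions of $t$ copies of $\delta\sigma^{-1}$ and $r$ copies of $\sigma^{-1}$, evaluated at $a$ (so $\mathcal{T}_{0,0}(a)=a$). Let $f=\sum_{i=0}^m a_ix^i$ and $g=\sum_{j=0}^n b_jx^j$ be elements of $\mathbb{F}_q[x;\sigma,\delta]$ of degrees $m$ and $n$, and put $$A_i=\sum_{j=0}^{m-i}(-1)^j\mathcal{T}_{j,i}(a_{j+i}),\qquad B_i=\sum_{j=0}^{n-i}(-1)^j\mathcal{T}_{j,i}(b_{j+i}),$$ so that $f=\sum_i x^iA_i$ and $g=\sum_i x^iB_i$. The left $(\sigma,\delta)$-Sylvester matrix of $f$ and $g$ is the $(m+n)\times(m+n)$ matrix, with columns numbered $q=0,\dots,m+n-1$, whose first $n$ rows ($p=0,\dots,n-1$) and last $m$ rows ($p=0,\dots,m-1$) have respectively the entries $$\sum_{\substack{0\le l\le p\\ 0\le q-l\le m}}(-1)^{p-l}\,\mathcal{T}_{p-l,l}(A_{q-l})\qquad\text{and}\qquad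 \sum_{\substack{0\le l\le p\\ 0\le q-l\le n}}(-1)^{p-l}\,\mathcal{T}_{p-l,l}(B_{q-l}).$$ The left $(\sigma,\delta)$-resultant $R^{\sigma,\delta}_{\mathbb{F}_q,L}(f,g)$ is the determinant of this matrix. Theorem. Two non-constant skew polynomials $f,g\in\mathbb{F}_q[x;\sigma,\delta]$ have a common left root in some polynomial ring extension $\tilde{\mathbb{F}}[x;\tilde\sigma,\tilde\delta]$ of $\mathbb{F}_q[x;\sigma,\delta]$, with $\tilde\sigma$ an automorphism, if and only if $R^{\sigma,\delta}_{\mathbb{F}_q,L}(f,g)=0$. -/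

import Mathlib

universe u v

/-- A `σ`-derivation of a ring `F`: an additive map `δ : F → F` such that
`δ (a * b) = σ a * δ b + δ a * b`. -/
structure SkewDerivation {F : Type*} [Ring F] (σ : F →+* F) extends F →+ F where
  leibniz' : ∀ a b : F, toFun (a * b) = σ a * toFun b + toFun a * b

instance {F : Type*} [Ring F] (σ : F →+* F) : CoeFun (SkewDerivation σ) (fun _ => F → F) :=
  ⟨fun δ => δ.toFun⟩

/-- The underlying set of the skew polynomial ring `F[x;σ,δ]`: the finitely supported sequences
`a`, where `a` stands for the polynomial `∑ aᵢ xⁱ` with coefficients written on the left. -/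
def OreExtension {F : Type*} [Ring F] (σ : F →+* F) (_δ : SkewDerivation σ) : Type _ := ℕ →₀ F

namespace OreExtension

noncomputable section

section Construction

variable {F : Type*} [Ring F] {σ : F →+* F} {δ : SkewDerivation σ}

instance : AddCommGroup (OreExtension σ δ) := inferInstanceAs (AddCommGroup (ℕ →₀ F))

/-- The coefficient of `xⁱ`, coefficients being written on the left. -/
def coeff (p : OreExtension σ δ) (i : ℕ) : F := (show ℕ →₀ F from p) i

/-- `monomial i a` is `a xⁱ`, additive in `a`. -/
def monomial (σ : F →+* F) (δ : SkewDerivation σ) (i : ℕ) : F →+ OreExtension σ δ :=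
  (Finsupp.singleAddHom i : F →+ (ℕ →₀ F))

/-- Additive maps out of `F[x;σ,δ]` are given by their values on the monomials. -/
def lift {A : Type*} [AddCommMonoid A] (φ : ℕ → F →+ A) : OreExtension σ δ →+ A :=
  (Finsupp.liftAddHom φ : (ℕ →₀ F) →+ A)

theorem lift_monomial {A : Type*} [AddCommMonoid A] (φ : ℕ → F →+ A) (i : ℕ) (a : F) :
    lift φ (monomial σ δ i a) = φ i a :=
  Finsupp.liftAddHom_apply_single φ i a

theorem addHom_ext {A : Type*} [AddCommMonoid A] {u v : OreExtension σ δ →+ A}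
    (h : ∀ i a, u (monomial σ δ i a) = v (monomial σ δ i a)) : u = v :=
  Finsupp.addHom_ext (f := (u : (ℕ →₀ F) →+ A)) (g := (v : (ℕ →₀ F) →+ A)) h

theorem end_ext {u v : AddMonoid.End (OreExtension σ δ)}
    (h : ∀ i a, u (monomial σ δ i a) = v (monomial σ δ i a)) : u = v :=
  addHom_ext (A := OreExtension σ δ) h

/-- Multiplication by a constant on the left: `a • b xʲ = (a b) xʲ`. -/
def constMul (a : F) : AddMonoid.End (OreExtension σ δ) :=
  (lift fun j => (monomial σ δ j).comp (AddMonoidHom.mulLeft a) :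
    OreExtension σ δ →+ OreExtension σ δ)

/-- Multiplication by `x` on the left: `x (b xʲ) = σ(b) xʲ⁺¹ + δ(b) xʲ`. -/
def xMul : AddMonoid.End (OreExtension σ δ) :=
  (lift fun j =>
    (monomial σ δ (j + 1)).comp (σ : F →+ F) + (monomial σ δ j).comp δ.toAddMonoidHom :
    OreExtension σ δ →+ OreExtension σ δ)

theorem constMul_monomial (a : F) (j : ℕ) (b : F) :
    constMul a (monomial σ δ j b) = monomial σ δ j (a * b) :=
  lift_monomial _ j b

theorem xMul_monomial (j : ℕ) (b : F) :
    xMul (monomial σ δ j b) = monomial σ δ (j + 1) (σ b) + monomial σ δ j (δ b) :=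
  lift_monomial _ j b

/-- Multiplication on the left by `a xⁱ`, as an additive function of `a`. -/
def monomialMul (i : ℕ) : F →+ AddMonoid.End (OreExtension σ δ) where
  toFun a := constMul a * xMul ^ i
  map_zero' := by
    have h : (constMul (0 : F) : AddMonoid.End (OreExtension σ δ)) = 0 :=
      end_ext fun j b => by
        rw [constMul_monomial, zero_mul, map_zero]
        rfl
    rw [h, zero_mul]
  map_add' a b := by
    have h : (constMul (a + b) : AddMonoid.End (OreExtension σ δ)) = constMul a + constMul b :=
      end_ext fun j c => by
        change _ = constMul a (monomial σ δ j c) + constMul b (monomial σ δ j c)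
        rw [constMul_monomial, constMul_monomial, constMul_monomial, add_mul, map_add]
    rw [h, add_mul]

/-- `mulHom p q` is the product `p q`; it is additive in `p` and in `q`, and
`(a xⁱ) q = a (x (x (⋯ (x q))))`. -/
def mulHom : OreExtension σ δ →+ AddMonoid.End (OreExtension σ δ) := lift monomialMul

instance : Mul (OreExtension σ δ) := ⟨fun p q => mulHom p q⟩

instance : One (OreExtension σ δ) := ⟨monomial σ δ 0 1⟩

theorem mul_def (p q : OreExtension σ δ) : p * q = mulHom p q := rfl

theorem one_def : (1 : OreExtension σ δ) = monomial σ δ 0 1 := rfl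

theorem mulHom_monomial (i : ℕ) (a : F) :
    mulHom (monomial σ δ i a) = constMul a * xMul ^ i :=
  lift_monomial _ i a

theorem constMul_constMul (a b : F) :
    (constMul (a * b) : AddMonoid.End (OreExtension σ δ)) = constMul a * constMul b :=
  end_ext fun j c => by
    change _ = constMul a (constMul b (monomial σ δ j c))
    simp only [constMul_monomial, mul_assoc]

theorem constMul_one : (constMul (1 : F) : AddMonoid.End (OreExtension σ δ)) = 1 :=
  end_ext fun j c => by
    change _ = monomial σ δ j c
    simp only [constMul_monomial, one_mul]

theorem xMul_constMul (b : F) :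
    (xMul * constMul b : AddMonoid.End (OreExtension σ δ)) =
      constMul (σ b) * xMul + constMul (δ b) :=
  end_ext fun j c => by
    change xMul (constMul b (monomial σ δ j c)) =
      constMul (σ b) (xMul (monomial σ δ j c)) + constMul (δ b) (monomial σ δ j c)
    have hl : δ (b * c) = σ b * δ c + δ b * c := δ.leibniz' b c
    simp only [constMul_monomial, xMul_monomial, map_add, map_mul, hl, add_assoc]

theorem mulHom_constMul (a : F) (q : OreExtension σ δ) :
    mulHom (constMul a q) = constMul a * mulHom q := by
  have h : (mulHom.comp (constMul a : OreExtension σ δ →+ OreExtension σ δ) : OreExtension σ δ →+ AddMonoid.End (OreExtension σ δ)) =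
      (AddMonoidHom.mulLeft (constMul a)).comp mulHom :=
    addHom_ext fun j b => by
      change mulHom (constMul a (monomial σ δ j b)) = constMul a * mulHom (monomial σ δ j b)
      rw [constMul_monomial, mulHom_monomial, mulHom_monomial, constMul_constMul, mul_assoc]
  exact DFunLike.congr_fun h q

theorem mulHom_xMul (q : OreExtension σ δ) :
    mulHom (xMul q) = xMul * mulHom q := by
  have h : (mulHom.comp (xMul : OreExtension σ δ →+ OreExtension σ δ) : OreExtension σ δ →+ AddMonoid.End (OreExtension σ δ)) =
      (AddMonoidHom.mulLeft xMul).comp mulHom :=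
    addHom_ext fun j b => by
      change mulHom (xMul (monomial σ δ j b)) = xMul * mulHom (monomial σ δ j b)
      rw [xMul_monomial, map_add, mulHom_monomial, mulHom_monomial, mulHom_monomial, ← mul_assoc,
        xMul_constMul, add_mul, mul_assoc, pow_succ']
  exact DFunLike.congr_fun h q

theorem mulHom_xMul_pow (i : ℕ) (q : OreExtension σ δ) :
    mulHom ((xMul ^ i) q) =
      (xMul ^ i : AddMonoid.End (OreExtension σ δ)) * mulHom q := by
  induction i with
  | zero => rw [pow_zero, one_mul]; rfl
  | succ i ih =>
    rw [pow_succ', mul_assoc, ← ih, ← mulHom_xMul]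
    rfl

theorem mulHom_mulHom (p q : OreExtension σ δ) :
    mulHom (mulHom p q) = mulHom p * mulHom q := by
  have h : ((mulHom : OreExtension σ δ →+ AddMonoid.End (OreExtension σ δ)).comp
      ((AddMonoidHom.eval q).comp mulHom)) = (AddMonoidHom.mulRight (mulHom q)).comp mulHom :=
    addHom_ext fun i a => by
      change mulHom (mulHom (monomial σ δ i a) q) = mulHom (monomial σ δ i a) * mulHom q
      rw [mulHom_monomial, mul_assoc, ← mulHom_xMul_pow, ← mulHom_constMul]
      rfl
  exact DFunLike.congr_fun h p

theorem xMul_pow_one (i : ℕ) :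
    (xMul ^ i : AddMonoid.End (OreExtension σ δ)) (monomial σ δ 0 1) = monomial σ δ i 1 := by
  induction i with
  | zero => rw [pow_zero]; rfl
  | succ i ih =>
    have h1 : δ 1 = 0 := by
      have h := δ.leibniz' 1 1
      simp only [mul_one, map_one, one_mul] at h
      exact left_eq_add.mp h
    rw [pow_succ']
    change xMul ((xMul ^ i : AddMonoid.End (OreExtension σ δ)) (monomial σ δ 0 1)) = _
    rw [ih, xMul_monomial, map_one, h1, map_zero, add_zero]

/-- `F[x;σ,δ]` is a ring. -/
instance : Ring (OreExtension σ δ) :=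
  { (inferInstance : AddCommGroup (OreExtension σ δ)),
    (inferInstance : Mul (OreExtension σ δ)),
    (inferInstance : One (OreExtension σ δ)) with
    left_distrib := fun p q r => map_add (mulHom p) q r
    right_distrib := fun p q r => by simp only [mul_def, map_add]; rfl
    zero_mul := fun p => by simp only [mul_def, map_zero]; rfl
    mul_zero := fun p => map_zero (mulHom p)
    mul_assoc := fun p q r => by
      simp only [mul_def, mulHom_mulHom]; rfl
    one_mul := fun p => by
      simp only [mul_def, one_def, mulHom_monomial, constMul_one, pow_zero, one_mul]; rfl
    mul_one := fun p => by
      have h : (AddMonoidHom.eval (1 : OreExtension σ δ)).comp mulHom =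
          AddMonoidHom.id (OreExtension σ δ) :=
        addHom_ext fun i a => by
          change mulHom (monomial σ δ i a) 1 = monomial σ δ i a
          rw [mulHom_monomial]
          change constMul a ((xMul ^ i : AddMonoid.End (OreExtension σ δ)) 1) = _
          rw [one_def, xMul_pow_one, constMul_monomial, mul_one]
      exact DFunLike.congr_fun h p }

/-- The constant skew polynomial `a`. -/
def C (σ : F →+* F) (δ : SkewDerivation σ) (a : F) : OreExtension σ δ := monomial σ δ 0 a

/-- The variable `x`. -/
def X (σ : F →+* F) (δ : SkewDerivation σ) : OreExtension σ δ := monomial σ δ 1 1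

/-- The commutation rule `x a = σ(a) x + δ(a)`. -/
theorem X_mul_C (a : F) : X σ δ * C σ δ a = C σ δ (σ a) * X σ δ + C σ δ (δ a) := by
  simp only [X, C, mul_def, mulHom_monomial, constMul_one, pow_one, pow_zero, one_mul, mul_one,
    constMul_monomial, xMul_monomial, zero_add]

/-- The left-hand normal form: `a xⁱ` is a product of a constant and a power of `x`. -/
theorem C_mul_X_pow (a : F) (i : ℕ) : C σ δ a * X σ δ ^ i = monomial σ δ i a := by
  have hX : ∀ i : ℕ, X σ δ ^ i = monomial σ δ i 1 := by
    intro i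
    induction i with
    | zero => rw [pow_zero]; rfl
    | succ i ih =>
      rw [pow_succ', ih]
      simp only [X, mul_def, mulHom_monomial, constMul_one, pow_one, one_mul]
      rw [← xMul_pow_one i, ← xMul_pow_one (i + 1), pow_succ']
      rfl
  rw [hX]
  simp only [C, mul_def, mulHom_monomial, pow_zero, mul_one, constMul_monomial]

/-- The degree (`0` for the zero polynomial). -/
def natDegree (p : OreExtension σ δ) : ℕ := (show ℕ →₀ F from p).support.sup id

/-- `a` is a left root of `f`: the remainder of the left division of `f` by `x - a` is zero. -/
def IsLeftRoot (a : F) (f : OreExtension σ δ) : Prop :=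
  ∃ q : OreExtension σ δ, f = (X σ δ - C σ δ a) * q

/-- Applying a ring homomorphism to all (left) coefficients. -/
def mapCoeff {K : Type*} [Ring K] (ι : F →+* K) (σ' : K →+* K) (δ' : SkewDerivation σ') :
    OreExtension σ δ →+ OreExtension σ' δ' :=
  (Finsupp.mapRange.addMonoidHom (ι : F →+ K) : (ℕ →₀ F) →+ (ℕ →₀ K))

end Construction

/-- `K[x;σ',δ']` is a polynomial ring extension of `F[x;σ,δ]`, where the division ring `F` is
regarded as a subring of the division ring `K` through the (automatically injective) `ι`:
`σ'` extends `σ` and `δ'` extends `δ`. -/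
structure IsPolynomialRingExtension {F K : Type*} [DivisionRing F] [DivisionRing K]
    (σ : F →+* F) (δ : SkewDerivation σ) (ι : F →+* K) (σ' : K →+* K)
    (δ' : SkewDerivation σ') : Prop where
  map_sigma : ∀ a : F, σ' (ι a) = ι (σ a)
  map_delta : ∀ a : F, δ' (ι a) = ι (δ a)

section Resultant

variable {F : Type*} [DivisionRing F] {σ : F →+* F}

/-- `leftComp hσ δ t r a` is `T_{t,r}(a)`: the sum of all compositions of `t` copies of `δ ∘ σ⁻¹`
and `r` copies of `σ⁻¹`, evaluated at `a`. The words are sorted by their outermost factor. -/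
def leftComp (hσ : Function.Bijective σ) (δ : SkewDerivation σ) : ℕ → ℕ → F → F
  | 0, 0, a => a
  | 0, r + 1, a => (RingEquiv.ofBijective σ hσ).symm (leftComp hσ δ 0 r a)
  | t + 1, 0, a => δ ((RingEquiv.ofBijective σ hσ).symm (leftComp hσ δ t 0 a))
  | t + 1, r + 1, a => δ ((RingEquiv.ofBijective σ hσ).symm (leftComp hσ δ t (r + 1) a)) +
      (RingEquiv.ofBijective σ hσ).symm (leftComp hσ δ (t + 1) r a)
  termination_by t r => t + r

variable {δ : SkewDerivation σ}

/-- The coefficient `Aᵢ = ∑_{j=0}^{m-i} (-1)ʲ T_{j,i}(a_{j+i})` of `xⁱ` when `f = ∑ aᵢ xⁱ`,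
of degree `m`, is written with coefficients on the right, `f = ∑ xⁱ Aᵢ`; it is zero for `i > m`. -/
def rightCoeff (hσ : Function.Bijective σ) (f : OreExtension σ δ) (i : ℕ) : F :=
  ∑ j ∈ Finset.range (f.natDegree + 1 - i), (-1) ^ j * leftComp hσ δ j i (f.coeff (j + i))

/-- The entry in row `p` and column `q` of the block of the left Sylvester matrix that belongs to
`f`: the sum of `(-1)^{p-l} T_{p-l,l}(A_{q-l})` over the `l` with `0 ≤ l ≤ p` and
`0 ≤ q - l ≤ deg f` (rows and columns are numbered from zero). -/
def leftSylvesterEntry (hσ : Function.Bijective σ) (f : OreExtension σ δ) (p q : ℕ) : F :=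
  ∑ l ∈ (Finset.range (p + 1)).filter (fun l => l ≤ q ∧ q - l ≤ f.natDegree),
    (-1) ^ (p - l) * leftComp hσ δ (p - l) l (rightCoeff hσ f (q - l))

/-- The left `(σ,δ)`-Sylvester matrix of `f` and `g`, of degrees `m` and `n`: the first `n` rows
belong to `f` and the last `m` rows to `g`. -/
def leftSylvester (hσ : Function.Bijective σ) (f g : OreExtension σ δ) :
    Matrix (Fin (f.natDegree + g.natDegree)) (Fin (f.natDegree + g.natDegree)) F :=
  Matrix.of fun p q =>
    if (p : ℕ) < g.natDegree then leftSylvesterEntry hσ f p q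
    else leftSylvesterEntry hσ g (p - g.natDegree) q

end Resultant

/-- The left `(σ,δ)`-resultant over a field: the determinant of the left Sylvester matrix (over a
field the Dieudonné determinant is the usual one). -/
def leftResultant {F : Type*} [Field F] {σ : F →+* F} {δ : SkewDerivation σ}
    (hσ : Function.Bijective σ) (f g : OreExtension σ δ) : F :=
  (leftSylvester hσ f g).det

/-- Every endomorphism of a finite field is an automorphism. -/
theorem bijective_of_finite {F : Type*} [Field F] [Finite F] (σ : F →+* F) :
    Function.Bijective σ :=
  Finite.injective_iff_bijective.mp σ.injective

end

end OreExtension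

namespace SkewDerivation

variable {F : Type*} [Ring F] {σ : F →+* F} (δ : SkewDerivation σ)

/-! Written with coefficients on the right, the rows of the Sylvester matrix are the coefficient
vectors of `f xᵖ` for `p < deg g` and of `g xᵖ` for `p < deg f`. Hence a row vector times the matrix
is the coefficient vector of `f u + g v`, with `deg u < deg g` and `deg v < deg f`
(`mul_add_mul_eq_sum_vecMul`).

If the determinant is nonzero, some `u`, `v` satisfy `f u + g v = 1`. This identity survives in
every extension, where a common left root `a` would make `x - a` a left factor of `1`, which degrees
forbid.

If the determinant vanishes, a kernel vector gives `f u + g v = 0` with `u ≠ 0`, and Euclidean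
division turns this into a common left factor `d` of positive degree (`exists_common_left_factor`).
It remains to give `d` a left root in an extension. Over a finite field `σ` is a power of Frobenius
and `δ` is inner (`exists_inner`), so both extend to the algebraic closure of the prime field. There
a shift of the variable removes `δ`, and finding a left root becomes finding a root of an ordinary
polynomial (`exists_isLeftRoot`). -/

theorem apply_zero : δ 0 = 0 := map_zero δ.toAddMonoidHom

theorem apply_add (a b : F) : δ (a + b) = δ a + δ b := map_add δ.toAddMonoidHom a b

end SkewDerivation

namespace OreExtension

/-! ### Coefficients and leading terms of products. -/

section Coeff

variable {F : Type*} [Ring F] {σ : F →+* F} {δ : SkewDerivation σ}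

@[ext]
theorem ext {p q : OreExtension σ δ} (h : ∀ i, p.coeff i = q.coeff i) : p = q :=
  Finsupp.ext (f := (p : ℕ →₀ F)) (g := (q : ℕ →₀ F)) h

@[simp]
theorem coeff_zero (i : ℕ) : (0 : OreExtension σ δ).coeff i = 0 := rfl

@[simp]
theorem coeff_add (p q : OreExtension σ δ) (i : ℕ) : (p + q).coeff i = p.coeff i + q.coeff i :=
  Finsupp.add_apply (p : ℕ →₀ F) (q : ℕ →₀ F) i

/-- Taking a coefficient, as an additive map. -/
def coeffHom (σ : F →+* F) (δ : SkewDerivation σ) (i : ℕ) : OreExtension σ δ →+ F where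
  toFun p := p.coeff i
  map_zero' := coeff_zero i
  map_add' p q := coeff_add p q i

@[simp]
theorem coeff_sub (p q : OreExtension σ δ) (i : ℕ) : (p - q).coeff i = p.coeff i - q.coeff i :=
  map_sub (coeffHom σ δ i) p q

theorem coeff_sum {ι : Type*} (s : Finset ι) (p : ι → OreExtension σ δ) (i : ℕ) :
    (∑ j ∈ s, p j).coeff i = ∑ j ∈ s, (p j).coeff i :=
  map_sum (coeffHom σ δ i) p s

theorem coeff_monomial (i j : ℕ) (a : F) :
    (monomial σ δ i a).coeff j = if i = j then a else 0 := by
  classical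
  exact Finsupp.single_apply

@[elab_as_elim]
theorem induction_monomial {P : OreExtension σ δ → Prop} (p : OreExtension σ δ) (h0 : P 0)
    (hadd : ∀ p q, P p → P q → P (p + q)) (hm : ∀ i a, P (monomial σ δ i a)) : P p :=
  Finsupp.induction_linear (motive := fun p : ℕ →₀ F => P p) p h0 hadd hm

theorem coeff_eq_zero_of_natDegree_lt {p : OreExtension σ δ} {i : ℕ} (h : p.natDegree < i) :
    p.coeff i = 0 := by
  by_contra hc
  have hs : i ∈ (show ℕ →₀ F from p).support := Finsupp.mem_support_iff.mpr hc
  exact absurd (Finset.le_sup (f := id) hs) (not_le.mpr h)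

theorem natDegree_le_iff {p : OreExtension σ δ} {n : ℕ} :
    p.natDegree ≤ n ↔ ∀ i, n < i → p.coeff i = 0 := by
  refine ⟨fun h i hi => coeff_eq_zero_of_natDegree_lt (h.trans_lt hi), fun h => ?_⟩
  refine Finset.sup_le fun i hi => ?_
  by_contra hc
  exact Finsupp.mem_support_iff.mp hi (h i (not_le.mp hc))

theorem coeff_natDegree_ne_zero {p : OreExtension σ δ} (hp : p ≠ 0) :
    p.coeff p.natDegree ≠ 0 := by
  have hs : (show ℕ →₀ F from p).support.Nonempty := Finsupp.support_nonempty_iff.mpr hp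
  obtain ⟨i, hi, h⟩ := Finset.exists_mem_eq_sup _ hs id
  have : p.natDegree = i := h
  rw [this]
  exact Finsupp.mem_support_iff.mp hi

theorem le_natDegree {p : OreExtension σ δ} {i : ℕ} (h : p.coeff i ≠ 0) : i ≤ p.natDegree := by
  by_contra hc
  exact h (coeff_eq_zero_of_natDegree_lt (not_le.mp hc))

theorem natDegree_eq_of_coeff {p : OreExtension σ δ} {n : ℕ} (h : ∀ i, n < i → p.coeff i = 0)
    (hn : p.coeff n ≠ 0) : p.natDegree = n :=
  le_antisymm (natDegree_le_iff.mpr h) (le_natDegree hn)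

theorem monomial_mul (i : ℕ) (a : F) (q : OreExtension σ δ) :
    monomial σ δ i a * q = C σ δ a * (X σ δ ^ i * q) := by
  rw [← C_mul_X_pow, mul_assoc]

theorem C_mul_monomial (a : F) (j : ℕ) (b : F) :
    C σ δ a * monomial σ δ j b = monomial σ δ j (a * b) := by
  rw [C, mul_def, mulHom_monomial, pow_zero, mul_one, constMul_monomial]

theorem X_mul_monomial (j : ℕ) (b : F) :
    X σ δ * monomial σ δ j b = monomial σ δ (j + 1) (σ b) + monomial σ δ j (δ b) := by
  rw [X, mul_def, mulHom_monomial, pow_one, constMul_one, one_mul, xMul_monomial]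

theorem C_mul_C (a b : F) : C σ δ a * C σ δ b = C σ δ (a * b) := C_mul_monomial a 0 b

theorem C_one : C σ δ 1 = 1 := rfl

theorem C_zero : C σ δ 0 = 0 := map_zero (monomial σ δ 0)

theorem C_add (a b : F) : C σ δ (a + b) = C σ δ a + C σ δ b := map_add (monomial σ δ 0) a b

theorem C_neg (a : F) : C σ δ (-a) = -C σ δ a := map_neg (monomial σ δ 0) a

theorem C_sub (a b : F) : C σ δ (a - b) = C σ δ a - C σ δ b := map_sub (monomial σ δ 0) a b

theorem C_sum {ι : Type*} (s : Finset ι) (a : ι → F) :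
    C σ δ (∑ j ∈ s, a j) = ∑ j ∈ s, C σ δ (a j) := map_sum (monomial σ δ 0) a s

theorem coeff_C (a : F) (i : ℕ) : (C σ δ a).coeff i = if i = 0 then a else 0 := by
  rw [C, coeff_monomial]
  simp only [eq_comm]

theorem coeff_one (i : ℕ) : (1 : OreExtension σ δ).coeff i = if i = 0 then 1 else 0 :=
  coeff_C 1 i

theorem coeff_X (i : ℕ) : (X σ δ).coeff i = if 1 = i then 1 else 0 := coeff_monomial 1 i 1

theorem natDegree_C (a : F) : (C σ δ a).natDegree = 0 :=
  Nat.le_zero.mp (natDegree_le_iff.mpr fun i hi => by rw [coeff_C, if_neg hi.ne'])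

theorem coeff_C_mul (a : F) (q : OreExtension σ δ) (k : ℕ) :
    (C σ δ a * q).coeff k = a * q.coeff k := by
  induction q using induction_monomial with
  | h0 => simp
  | hadd p q hp hq => rw [mul_add, coeff_add, hp, hq, coeff_add, mul_add]
  | hm j b => rw [C_mul_monomial, coeff_monomial, coeff_monomial, mul_ite, mul_zero]

theorem coeff_X_mul_succ (q : OreExtension σ δ) (k : ℕ) :
    (X σ δ * q).coeff (k + 1) = σ (q.coeff k) + δ (q.coeff (k + 1)) := by
  induction q using induction_monomial with
  | h0 => simp [δ.apply_zero]
  | hadd p q hp hq =>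
    rw [mul_add, coeff_add, hp, hq, coeff_add, coeff_add, map_add, δ.apply_add]
    abel
  | hm j b =>
    rw [X_mul_monomial, coeff_add, coeff_monomial, coeff_monomial, coeff_monomial, coeff_monomial]
    simp only [add_left_inj]
    split_ifs <;> simp [δ.apply_zero]

theorem coeff_X_mul_zero (q : OreExtension σ δ) :
    (X σ δ * q).coeff 0 = δ (q.coeff 0) := by
  induction q using induction_monomial with
  | h0 => simp [δ.apply_zero]
  | hadd p q hp hq => rw [mul_add, coeff_add, hp, hq, coeff_add, δ.apply_add]
  | hm j b =>
    rw [X_mul_monomial, coeff_add, coeff_monomial, coeff_monomial, coeff_monomial]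
    split_ifs <;> simp_all [δ.apply_zero]

theorem coeff_X_pow_mul_of_lt {q : OreExtension σ δ} {n : ℕ} (h : ∀ k, n < k → q.coeff k = 0)
    (i k : ℕ) (hk : i + n < k) : (X σ δ ^ i * q).coeff k = 0 := by
  induction i generalizing k with
  | zero => rw [pow_zero, one_mul]; exact h k (by omega)
  | succ i ih =>
    obtain ⟨k, rfl⟩ : ∃ l, k = l + 1 := ⟨k - 1, by omega⟩
    rw [pow_succ', mul_assoc, coeff_X_mul_succ, ih k (by omega), ih (k + 1) (by omega), map_zero,
      δ.apply_zero, add_zero]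

theorem coeff_X_pow_mul_top {q : OreExtension σ δ} {n : ℕ} (h : ∀ k, n < k → q.coeff k = 0)
    (i : ℕ) : (X σ δ ^ i * q).coeff (i + n) = σ^[i] (q.coeff n) := by
  induction i with
  | zero => simp
  | succ i ih =>
    rw [pow_succ', mul_assoc, show i + 1 + n = i + n + 1 by omega, coeff_X_mul_succ, ih,
      coeff_X_pow_mul_of_lt h i _ (by omega), δ.apply_zero, add_zero, Function.iterate_succ_apply']

theorem eq_sum_monomial {p : OreExtension σ δ} {m : ℕ} (h : ∀ k, m < k → p.coeff k = 0) :
    p = ∑ i ∈ Finset.range (m + 1), monomial σ δ i (p.coeff i) := by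
  ext k
  simp only [coeff_sum, coeff_monomial, Finset.sum_ite_eq', Finset.mem_range]
  split_ifs with hk
  · rfl
  · exact h k (by omega)

theorem coeff_mul_of_lt {p q : OreExtension σ δ} {m n : ℕ} (hp : ∀ k, m < k → p.coeff k = 0)
    (hq : ∀ k, n < k → q.coeff k = 0) {k : ℕ} (hk : m + n < k) : (p * q).coeff k = 0 := by
  rw [eq_sum_monomial hp, Finset.sum_mul, coeff_sum]
  refine Finset.sum_eq_zero fun i hi => ?_
  rw [monomial_mul, coeff_C_mul, coeff_X_pow_mul_of_lt hq, mul_zero]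
  have := Finset.mem_range.mp hi
  omega

theorem coeff_mul_top {p q : OreExtension σ δ} {m n : ℕ} (hp : ∀ k, m < k → p.coeff k = 0)
    (hq : ∀ k, n < k → q.coeff k = 0) :
    (p * q).coeff (m + n) = p.coeff m * σ^[m] (q.coeff n) := by
  nth_rw 1 [eq_sum_monomial hp]
  rw [Finset.sum_mul, coeff_sum, Finset.sum_range_succ, Finset.sum_eq_zero, zero_add, monomial_mul,
    coeff_C_mul, coeff_X_pow_mul_top hq]
  intro i hi
  rw [monomial_mul, coeff_C_mul, coeff_X_pow_mul_of_lt hq, mul_zero]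
  have := Finset.mem_range.mp hi
  omega

end Coeff

/-! ### Change of coefficients to an extension. -/

section Map

variable {F K : Type*} [DivisionRing F] [DivisionRing K] {σ : F →+* F} {δ : SkewDerivation σ}
  {ι : F →+* K} {σ' : K →+* K} {δ' : SkewDerivation σ'}

theorem coeff_mapCoeff (p : OreExtension σ δ) (i : ℕ) :
    (mapCoeff ι σ' δ' p).coeff i = ι (p.coeff i) := rfl

theorem mapCoeff_C (a : F) : mapCoeff ι σ' δ' (C σ δ a) = C σ' δ' (ι a) := by
  ext i
  rw [coeff_mapCoeff, coeff_C, coeff_C]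
  split_ifs <;> simp

theorem natDegree_mapCoeff (p : OreExtension σ δ) :
    (mapCoeff ι σ' δ' p).natDegree = p.natDegree := by
  by_cases hp : p = 0
  · rw [hp, map_zero]
    rfl
  · refine natDegree_eq_of_coeff (fun i hi => ?_) ?_
    · rw [coeff_mapCoeff, coeff_eq_zero_of_natDegree_lt hi, map_zero]
    · rw [coeff_mapCoeff]
      exact (map_ne_zero ι).mpr (coeff_natDegree_ne_zero hp)

theorem mapCoeff_C_mul (a : F) (q : OreExtension σ δ) :
    mapCoeff ι σ' δ' (C σ δ a * q) = C σ' δ' (ι a) * mapCoeff ι σ' δ' q := by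
  ext i
  rw [coeff_mapCoeff, coeff_C_mul, coeff_C_mul, coeff_mapCoeff, map_mul]

theorem IsPolynomialRingExtension.mapCoeff_X_mul (h : IsPolynomialRingExtension σ δ ι σ' δ')
    (q : OreExtension σ δ) :
    mapCoeff ι σ' δ' (X σ δ * q) = X σ' δ' * mapCoeff ι σ' δ' q := by
  ext i
  rw [coeff_mapCoeff]
  cases i with
  | zero => rw [coeff_X_mul_zero, coeff_X_mul_zero, coeff_mapCoeff, ← h.map_delta]
  | succ i =>
    rw [coeff_X_mul_succ, coeff_X_mul_succ, coeff_mapCoeff, coeff_mapCoeff, map_add, h.map_sigma,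
      ← h.map_delta]

/-- Left multiplications by constants and by `x` generate all left multiplications, and each is
compatible with the coefficient map. -/
theorem IsPolynomialRingExtension.mapCoeff_mul (h : IsPolynomialRingExtension σ δ ι σ' δ')
    (p q : OreExtension σ δ) :
    mapCoeff ι σ' δ' (p * q) = mapCoeff ι σ' δ' p * mapCoeff ι σ' δ' q := by
  have hX : ∀ i (r : OreExtension σ δ),
      mapCoeff ι σ' δ' (X σ δ ^ i * r) = X σ' δ' ^ i * mapCoeff ι σ' δ' r := by
    intro i r
    induction i with
    | zero => rw [pow_zero, pow_zero, one_mul, one_mul]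
    | succ i ih => rw [pow_succ', pow_succ', mul_assoc, mul_assoc, h.mapCoeff_X_mul, ih]
  induction p using induction_monomial with
  | h0 => rw [zero_mul, map_zero, zero_mul]
  | hadd p q hp hq => rw [add_mul, map_add, map_add, add_mul, hp, hq]
  | hm i a =>
    have hm : mapCoeff ι σ' δ' (monomial σ δ i a) = monomial σ' δ' i (ι a) := by
      ext k
      rw [coeff_mapCoeff, coeff_monomial, coeff_monomial]
      split_ifs <;> simp
    rw [hm, monomial_mul, monomial_mul, mapCoeff_C_mul, hX]

end Map

/-! ### Degrees, Euclidean division and common left factors over a division ring. -/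

section DivisionRing

variable {F : Type*} [DivisionRing F] {σ : F →+* F} {δ : SkewDerivation σ}

/-- The leading coefficient of the product is `a σᵐ(b)`, with `a`, `b` the leading coefficients and
`m = deg p`; it is nonzero because `σ` is injective. -/
theorem mul_ne_zero_and_natDegree_mul {p q : OreExtension σ δ} (hp : p ≠ 0) (hq : q ≠ 0) :
    p * q ≠ 0 ∧ (p * q).natDegree = p.natDegree + q.natDegree := by
  have hp' : ∀ k, p.natDegree < k → p.coeff k = 0 := fun _ => coeff_eq_zero_of_natDegree_lt
  have hq' : ∀ k, q.natDegree < k → q.coeff k = 0 := fun _ => coeff_eq_zero_of_natDegree_lt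
  have h : (p * q).coeff (p.natDegree + q.natDegree) ≠ 0 := by
    rw [coeff_mul_top hp' hq']
    refine mul_ne_zero (coeff_natDegree_ne_zero hp) ?_
    rw [← RingHom.coe_pow]
    exact (map_ne_zero _).mpr (coeff_natDegree_ne_zero hq)
  exact ⟨fun h0 => h (by rw [h0, coeff_zero]),
    natDegree_eq_of_coeff (fun k hk => coeff_mul_of_lt hp' hq' hk) h⟩

instance : NoZeroDivisors (OreExtension σ δ) where
  eq_zero_or_eq_zero_of_mul_eq_zero {p q} h := by
    by_contra! hc
    exact (mul_ne_zero_and_natDegree_mul hc.1 hc.2).1 h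

theorem natDegree_mul {p q : OreExtension σ δ} (hp : p ≠ 0) (hq : q ≠ 0) :
    (p * q).natDegree = p.natDegree + q.natDegree :=
  (mul_ne_zero_and_natDegree_mul hp hq).2

/-- Division of `f` by `g` with the quotient on the right. -/
theorem exists_eq_mul_add (hσ : Function.Surjective σ) (f : OreExtension σ δ)
    {g : OreExtension σ δ} (hg : g ≠ 0) :
    ∃ q r, f = g * q + r ∧ (r = 0 ∨ r.natDegree < g.natDegree) := by
  have key : ∀ N (f : OreExtension σ δ), (∀ k, N ≤ k → f.coeff k = 0) →
      ∃ q r, f = g * q + r ∧ (r = 0 ∨ r.natDegree < g.natDegree) := by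
    intro N
    induction N with
    | zero =>
      intro f hf
      exact ⟨0, 0, by ext k; simp [hf k], Or.inl rfl⟩
    | succ N ih =>
      intro f hf
      by_cases hN : N < g.natDegree
      · refine ⟨0, f, by simp, Or.inr (lt_of_le_of_lt (natDegree_le_iff.mpr fun k hk => ?_) hN)⟩
        exact hf k hk
      obtain ⟨k, rfl⟩ := Nat.exists_eq_add_of_le (not_lt.mp hN)
      -- The leading coefficient of `g c xᵏ` is that of `g` times `σᵐ(c)`, with `m = deg g`;
      -- surjectivity of `σ` lets it match that of `f`.
      obtain ⟨c, hc⟩ := hσ.iterate g.natDegree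
        ((g.coeff g.natDegree)⁻¹ * f.coeff (g.natDegree + k))
      have hg' : ∀ k, g.natDegree < k → g.coeff k = 0 := fun _ => coeff_eq_zero_of_natDegree_lt
      have hm : ∀ j, k < j → (monomial σ δ k c).coeff j = 0 := fun j hj => by
        rw [coeff_monomial, if_neg hj.ne]
      obtain ⟨q, r, h, hr⟩ := ih (f - g * monomial σ δ k c) fun j hj => by
        rw [coeff_sub]
        rcases hj.lt_or_eq with hj | rfl
        · rw [hf j hj, coeff_mul_of_lt hg' hm hj, sub_zero]
        · rw [coeff_mul_top hg' hm, coeff_monomial, if_pos rfl, hc,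
            mul_inv_cancel_left₀ (coeff_natDegree_ne_zero hg), sub_self]
      exact ⟨monomial σ δ k c + q, r, by rw [mul_add, add_assoc, ← h]; abel, hr⟩
  exact key (f.natDegree + 1) f fun k hk => coeff_eq_zero_of_natDegree_lt hk

/-- A relation `f u = g v` of degree less than that of `f g` forces a common left factor. -/
theorem exists_common_left_factor (hσ : Function.Surjective σ) {f g u v : OreExtension σ δ}
    (hg : g ≠ 0) (hu : u ≠ 0) (hdeg : u.natDegree < g.natDegree) (h : f * u = g * v) :
    ∃ d f' g', 0 < d.natDegree ∧ f = d * f' ∧ g = d * g' := by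
  induction hn : g.natDegree using Nat.strong_induction_on generalizing f g u v with
  | _ n ih =>
    subst hn
    obtain ⟨q, r, hf, hr⟩ := exists_eq_mul_add hσ f hg
    by_cases hr0 : r = 0
    · exact ⟨g, q, 1, by omega, by rw [hf, hr0, add_zero], (mul_one g).symm⟩
    have hr := hr.resolve_left hr0
    -- The relation passes to the pair `(g, r)`. Since `deg u < deg g`, comparing degrees gives `deg
    -- (v - q u) < deg r`, the bound needed for the induction.
    have h' : g * (v - q * u) = r * u := by
      rw [mul_sub, ← h, hf]
      noncomm_ring
    have hv : v - q * u ≠ 0 := fun h0 => by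
      rw [h0, mul_zero] at h'
      exact mul_ne_zero hr0 hu h'.symm
    have hd := congrArg natDegree h'
    rw [natDegree_mul hg hv, natDegree_mul hr0 hu] at hd
    obtain ⟨d, g', r', hd, hg', hr'⟩ := ih _ hr hr0 hv (by omega) h' rfl
    exact ⟨d, g' * q + r', g', hd, by rw [mul_add, ← mul_assoc, ← hg', ← hr', hf], hg'⟩

/-- The powers of `x` are independent over the constants acting on the right. -/
theorem eq_zero_of_sum_X_pow_mul_C_eq_zero {n : ℕ} {w : ℕ → F}
    (h : ∑ i ∈ Finset.range n, X σ δ ^ i * C σ δ (w i) = 0) : ∀ i < n, w i = 0 := by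
  have hC : ∀ i k, 0 < k → (C σ δ (w i)).coeff k = 0 := fun i k hk => by
    rw [coeff_C, if_neg hk.ne']
  induction n with
  | zero => intro i hi; omega
  | succ n ih =>
    have hn : w n = 0 := by
      have h' := congrArg (fun p => p.coeff n) h
      rw [Finset.sum_range_succ, coeff_add, coeff_sum, Finset.sum_eq_zero, zero_add, coeff_zero] at h'
      · have := coeff_X_pow_mul_top (hC n) n
        rw [add_zero, h', coeff_C, if_pos rfl, ← RingHom.coe_pow] at this
        exact (map_eq_zero _).mp this.symm
      · intro i hi
        exact coeff_X_pow_mul_of_lt (hC i) i n (by simpa using hi)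
    rw [Finset.sum_range_succ, hn, C_zero, mul_zero, add_zero] at h
    intro i hi
    rcases Nat.lt_succ_iff_lt_or_eq.mp hi with hi | rfl
    · exact ih h i hi
    · exact hn

theorem natDegree_sum_X_pow_mul_C_lt {n : ℕ} (hn : 0 < n) (w : ℕ → F) :
    (∑ i ∈ Finset.range n, X σ δ ^ i * C σ δ (w i)).natDegree < n := by
  refine Nat.lt_of_le_pred hn (natDegree_le_iff.mpr fun k hk => ?_)
  rw [coeff_sum]
  refine Finset.sum_eq_zero fun i hi => ?_
  have := Finset.mem_range.mp hi
  rw [Nat.pred_eq_sub_one] at hk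
  exact coeff_X_pow_mul_of_lt (n := 0) (fun k hk => by rw [coeff_C, if_neg hk.ne']) i k (by omega)

end DivisionRing

end OreExtension

namespace OreExtension

/-! ### Right coefficients and the rows of the Sylvester matrix. -/

section RightCoeff

variable {F : Type*} [DivisionRing F] {σ : F →+* F} {δ : SkewDerivation σ}

theorem map_neg_one_pow_mul {G : Type*} [Ring G] (φ : G →+ G) (t : ℕ) (a : G) :
    φ ((-1) ^ t * a) = (-1) ^ t * φ a := by
  rcases neg_one_pow_eq_or G t with h | h <;> simp [h]

theorem C_mul_X (hσ : Function.Bijective σ) (a : F) :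
    C σ δ a * X σ δ = X σ δ * C σ δ ((RingEquiv.ofBijective σ hσ).symm a) +
      C σ δ (-δ ((RingEquiv.ofBijective σ hσ).symm a)) := by
  have h : σ ((RingEquiv.ofBijective σ hσ).symm a) = a :=
    (RingEquiv.ofBijective σ hσ).apply_symm_apply a
  rw [X_mul_C, h, C_neg, add_neg_cancel_right]

/-- A signed Pascal rule, splitting words by their outermost letter. It matches the two terms
produced when a constant moves past one more `x` in `C_mul_X`. -/
theorem neg_one_pow_mul_leftComp (hσ : Function.Bijective σ) (a : F) (p : ℕ) (t r : ℕ)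
    (h : t + r = p + 1) :
    (-1) ^ t * leftComp hσ δ t r a =
      (if r = 0 then 0 else
        (RingEquiv.ofBijective σ hσ).symm ((-1) ^ t * leftComp hσ δ t (r - 1) a)) +
      (if t = 0 then 0 else
        -δ ((RingEquiv.ofBijective σ hσ).symm ((-1) ^ (t - 1) * leftComp hσ δ (t - 1) r a))) := by
  have hs : ∀ t b, (RingEquiv.ofBijective σ hσ).symm ((-1) ^ t * b) =
      (-1) ^ t * (RingEquiv.ofBijective σ hσ).symm b := fun t b =>
    map_neg_one_pow_mul ((RingEquiv.ofBijective σ hσ).symm : F →+ F) t b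
  have hd : ∀ t b, δ ((-1) ^ t * b) = (-1) ^ t * δ b := fun t b =>
    map_neg_one_pow_mul δ.toAddMonoidHom t b
  match t, r with
  | 0, 0 => omega
  | 0, r + 1 => simp [leftComp]
  | t + 1, 0 => simp [leftComp, hs, hd, pow_succ]
  | t + 1, r + 1 =>
    rw [leftComp, if_neg r.succ_ne_zero, if_neg t.succ_ne_zero, hs, hs, hd, Nat.add_sub_cancel,
      Nat.add_sub_cancel, pow_succ]
    noncomm_ring

/-- A constant times a power of `x`, rewritten with coefficients on the right. -/
theorem C_mul_X_pow_eq_sum (hσ : Function.Bijective σ) (a : F) (p : ℕ) :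
    C σ δ a * X σ δ ^ p = ∑ x ∈ Finset.HasAntidiagonal.antidiagonal p,
      X σ δ ^ x.2 * C σ δ ((-1) ^ x.1 * leftComp hσ δ x.1 x.2 a) := by
  induction p with
  | zero => simp [leftComp]
  | succ p ih =>
    rw [pow_succ, ← mul_assoc, ih, Finset.sum_mul]
    have hR : ∀ x ∈ Finset.HasAntidiagonal.antidiagonal (p + 1),
        X σ δ ^ x.2 * C σ δ ((-1) ^ x.1 * leftComp hσ δ x.1 x.2 a) = _ := fun x hx => by
      rw [neg_one_pow_mul_leftComp hσ a p x.1 x.2 (Finset.HasAntidiagonal.mem_antidiagonal.mp hx), C_add, mul_add]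
    rw [Finset.sum_congr rfl hR, Finset.sum_add_distrib, Finset.Nat.sum_antidiagonal_succ',
      Finset.Nat.sum_antidiagonal_succ]
    simp only [if_true, C_zero, mul_zero, zero_add, Nat.add_eq_zero_iff, one_ne_zero,
      and_false, if_false, Nat.add_sub_cancel]
    rw [← Finset.sum_add_distrib]
    refine Finset.sum_congr rfl fun x _ => ?_
    rw [mul_assoc, C_mul_X hσ, mul_add, ← mul_assoc, ← pow_succ]

theorem eq_sum_rightCoeff (hσ : Function.Bijective σ) (f : OreExtension σ δ) :
    f = ∑ i ∈ Finset.range (f.natDegree + 1), X σ δ ^ i * C σ δ (rightCoeff hσ f i) := by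
  nth_rw 1 [eq_sum_monomial (p := f) fun k hk => coeff_eq_zero_of_natDegree_lt hk]
  simp only [← C_mul_X_pow, C_mul_X_pow_eq_sum hσ, rightCoeff, C_sum, Finset.mul_sum]
  rw [Finset.sum_sigma', Finset.sum_sigma']
  -- Reindexing from (left exponent, number of `δ σ⁻¹`, number of `σ⁻¹`) to (right exponent, number
  -- of `δ σ⁻¹`); the left exponent is the sum of the two.
  refine Finset.sum_bij' (fun x _ => ⟨x.2.2, x.2.1⟩) (fun y _ => ⟨y.2 + y.1, (y.2, y.1)⟩)
    ?_ ?_ ?_ ?_ ?_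
  · rintro ⟨k, j, i⟩ h
    simp only [Finset.mem_sigma, Finset.mem_range, Finset.HasAntidiagonal.mem_antidiagonal] at h ⊢
    omega
  · rintro ⟨i, j⟩ h
    simp only [Finset.mem_sigma, Finset.mem_range, Finset.HasAntidiagonal.mem_antidiagonal, and_true]
      at h ⊢
    omega
  · rintro ⟨k, j, i⟩ h
    simp only [Finset.mem_sigma, Finset.mem_range, Finset.HasAntidiagonal.mem_antidiagonal] at h ⊢
    obtain ⟨-, rfl⟩ := h
    rfl
  · rintro ⟨i, j⟩ h
    rfl
  · rintro ⟨k, j, i⟩ h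
    simp only [Finset.mem_sigma, Finset.mem_range, Finset.HasAntidiagonal.mem_antidiagonal] at h ⊢
    obtain ⟨-, rfl⟩ := h
    rfl

/-- The rows of the Sylvester matrix hold the right coefficients of `f xᵖ`. -/
theorem mul_X_pow_eq_sum_leftSylvesterEntry (hσ : Function.Bijective σ) (f : OreExtension σ δ)
    {p N : ℕ} (hN : f.natDegree + p < N) :
    f * X σ δ ^ p = ∑ q ∈ Finset.range N, X σ δ ^ q * C σ δ (leftSylvesterEntry hσ f p q) := by
  nth_rw 1 [eq_sum_rightCoeff hσ f]
  simp only [Finset.sum_mul, mul_assoc, C_mul_X_pow_eq_sum hσ, leftSylvesterEntry, C_sum,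
    Finset.mul_sum]
  rw [Finset.sum_sigma', Finset.sum_sigma']
  -- Moving the constant in `xⁱ Aᵢ` past `xᵖ` leaves `l` factors `x` to its left, so the term lands
  -- in column `q = i + l`.
  refine Finset.sum_bij' (fun x _ => ⟨x.1 + x.2.2, x.2.2⟩)
    (fun y _ => ⟨y.1 - y.2, (p - y.2, y.2)⟩) ?_ ?_ ?_ ?_ ?_
  · rintro ⟨i, t, r⟩ h
    simp only [Finset.mem_sigma, Finset.mem_range, Finset.HasAntidiagonal.mem_antidiagonal, Finset.mem_filter]
      at h ⊢
    omega
  · rintro ⟨q, l⟩ h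
    simp only [Finset.mem_sigma, Finset.mem_range, Finset.HasAntidiagonal.mem_antidiagonal, Finset.mem_filter]
      at h ⊢
    omega
  · rintro ⟨i, t, r⟩ h
    simp only [Finset.mem_sigma, Finset.mem_range, Finset.HasAntidiagonal.mem_antidiagonal] at h ⊢
    obtain ⟨-, rfl⟩ := h
    simp
  · rintro ⟨q, l⟩ h
    simp only [Finset.mem_sigma, Finset.mem_range, Finset.mem_filter] at h ⊢
    rw [Nat.sub_add_cancel (by omega)]
  · rintro ⟨i, t, r⟩ h
    simp only [Finset.mem_sigma, Finset.mem_range, Finset.HasAntidiagonal.mem_antidiagonal] at h ⊢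
    obtain ⟨-, rfl⟩ := h
    simp only [Nat.add_sub_cancel]
    rw [← mul_assoc, ← pow_add]

end RightCoeff

/-! ### Consequences of the vanishing or nonvanishing of the resultant. -/

section Resultant

variable {F : Type*} [Field F] {σ : F →+* F} {δ : SkewDerivation σ}

open Matrix in
/-- A row vector times the Sylvester matrix is the vector of right coefficients of `f u + g v`,
where the right coefficients of `u` and `v` are the entries of the row vector. -/
theorem mul_add_mul_eq_sum_vecMul (hσ : Function.Bijective σ) (f g : OreExtension σ δ)
    (w : ℕ → F) :
    f * (∑ p ∈ Finset.range g.natDegree, X σ δ ^ p * C σ δ (w p)) +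
      g * (∑ p ∈ Finset.range f.natDegree, X σ δ ^ p * C σ δ (w (g.natDegree + p))) =
    ∑ q : Fin (f.natDegree + g.natDegree), X σ δ ^ (q : ℕ) *
      C σ δ (((fun p : Fin (f.natDegree + g.natDegree) => w p) ᵥ* leftSylvester hσ f g) q) := by
  have hrow : ∀ (h : OreExtension σ δ) (p : ℕ) (c : F),
      h.natDegree + p < f.natDegree + g.natDegree →
      h * (X σ δ ^ p * C σ δ c) = ∑ q ∈ Finset.range (f.natDegree + g.natDegree),
        X σ δ ^ q * C σ δ (c * leftSylvesterEntry hσ h p q) := fun h p c hp => by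
    rw [← mul_assoc, mul_X_pow_eq_sum_leftSylvesterEntry hσ h hp, Finset.sum_mul]
    -- Commutativity of `F` moves the multiplier from the right of the entry to the left, as the
    -- vector-matrix product requires.
    exact Finset.sum_congr rfl fun q _ => by rw [mul_assoc, C_mul_C, mul_comm c]
  have hrows : ∑ p ∈ Finset.range (g.natDegree + f.natDegree),
      ∑ q ∈ Finset.range (f.natDegree + g.natDegree), X σ δ ^ q *
        C σ δ (w p * if p < g.natDegree then leftSylvesterEntry hσ f p q
          else leftSylvesterEntry hσ g (p - g.natDegree) q) =
      f * (∑ p ∈ Finset.range g.natDegree, X σ δ ^ p * C σ δ (w p)) +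
      g * (∑ p ∈ Finset.range f.natDegree, X σ δ ^ p * C σ δ (w (g.natDegree + p))) := by
    rw [Finset.sum_range_add, Finset.mul_sum, Finset.mul_sum]
    congr 1
    · refine Finset.sum_congr rfl fun p hp => ?_
      have hp := Finset.mem_range.mp hp
      rw [hrow f p _ (by omega)]
      simp only [if_pos hp]
    · refine Finset.sum_congr rfl fun p hp => ?_
      have hp := Finset.mem_range.mp hp
      rw [hrow g p _ (by omega)]
      simp
  rw [← hrows, Finset.sum_comm, Finset.sum_range]
  refine Finset.sum_congr rfl fun q _ => ?_
  rw [← Finset.mul_sum, ← C_sum, add_comm g.natDegree, Finset.sum_range]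
  rfl

theorem exists_mul_add_mul_eq_one (hσ : Function.Bijective σ) {f : OreExtension σ δ}
    (g : OreExtension σ δ) (hf : 0 < f.natDegree)
    (h : leftResultant hσ f g ≠ 0) :
    ∃ u v, f * u + g * v = 1 := by
  have hdet : IsUnit (leftSylvester hσ f g).det := isUnit_iff_ne_zero.mpr h
  have hpos : 0 < f.natDegree + g.natDegree := Nat.add_pos_left hf _
  -- The coefficient vector of the constant `1`; its preimage under the matrix supplies `u` and `v`.
  let e : Fin (f.natDegree + g.natDegree) → F := Pi.single ⟨0, hpos⟩ 1
  let w := Matrix.vecMul e (leftSylvester hσ f g)⁻¹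
  let w' : ℕ → F := fun p => if hp : p < f.natDegree + g.natDegree then w ⟨p, hp⟩ else 0
  have hw : (fun p : Fin (f.natDegree + g.natDegree) => w' p) = w := by
    funext p
    simp [w']
  refine ⟨_, _, (mul_add_mul_eq_sum_vecMul hσ f g w').trans ?_⟩
  rw [hw, Matrix.vecMul_vecMul, Matrix.nonsing_inv_mul _ hdet, Matrix.vecMul_one,
    Finset.sum_eq_single ⟨0, hpos⟩]
  · simp [e, C_one]
  · intro q _ hq
    simp [e, Pi.single_eq_of_ne hq, C_zero]
  · simp

theorem exists_common_left_factor_of_leftResultant_eq_zero (hσ : Function.Bijective σ)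
    {f g : OreExtension σ δ} (hg : 0 < g.natDegree)
    (h : leftResultant hσ f g = 0) :
    ∃ d f' g', 0 < d.natDegree ∧ f = d * f' ∧ g = d * g' := by
  obtain ⟨w, hw, hM⟩ := Matrix.exists_vecMul_eq_zero_iff.mpr h
  let w' : ℕ → F := fun p => if hp : p < f.natDegree + g.natDegree then w ⟨p, hp⟩ else 0
  have hw' : (fun p : Fin (f.natDegree + g.natDegree) => w' p) = w := by
    funext p
    simp [w']
  have hg0 : g ≠ 0 := by
    rintro rfl
    exact absurd hg (lt_irrefl 0)
  have key := mul_add_mul_eq_sum_vecMul hσ f g w'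
  rw [hw', hM] at key
  simp only [Pi.zero_apply, C_zero, mul_zero, Finset.sum_const_zero] at key
  have hlt := natDegree_sum_X_pow_mul_C_lt (σ := σ) (δ := δ) hg w'
  have hu0 := fun h0 => eq_zero_of_sum_X_pow_mul_C_eq_zero (σ := σ) (δ := δ)
    (n := g.natDegree) (w := w') h0
  have hv0 := fun h0 => eq_zero_of_sum_X_pow_mul_C_eq_zero (σ := σ) (δ := δ)
    (n := f.natDegree) (w := fun p => w' (g.natDegree + p)) h0
  generalize ∑ p ∈ Finset.range g.natDegree, X σ δ ^ p * C σ δ (w' p) = u at *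
  generalize ∑ p ∈ Finset.range f.natDegree, X σ δ ^ p * C σ δ (w' (g.natDegree + p)) = v at *
  -- If `u = 0` then `g v = 0`, so `v = 0` as well and both halves of the kernel vector vanish.
  have hu : u ≠ 0 := by
    rintro rfl
    rw [mul_zero, zero_add] at key
    have hv := hv0 ((mul_eq_zero.mp key).resolve_left hg0)
    apply hw
    rw [← hw']
    funext ⟨p, hp⟩
    rcases lt_or_ge p g.natDegree with hpg | hpg
    · exact hu0 rfl p hpg
    · have := hv (p - g.natDegree) (by omega)
      rwa [Nat.add_sub_cancel' hpg] at this
  exact exists_common_left_factor hσ.2 hg0 hu hlt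
    (v := -v) (by rw [mul_neg]; exact eq_neg_of_add_eq_zero_left key)

end Resultant

end OreExtension

namespace OreExtension

section InnerDerivation

/-- Every `σ`-derivation of a finite field is inner. -/
theorem exists_inner {F : Type*} [Field F] [Finite F] {σ : F →+* F} (δ : SkewDerivation σ) :
    ∃ c : F, ∀ a, δ a = c * (σ a - a) := by
  by_cases h : ∃ b, σ b ≠ b
  · obtain ⟨b, hb⟩ := h
    refine ⟨δ b / (σ b - b), fun a => ?_⟩
    have h1 : δ (a * b) = σ a * δ b + δ a * b := δ.leibniz' a b
    have h2 : δ (b * a) = σ b * δ a + δ b * a := δ.leibniz' b a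
    -- Expanding `δ (a b) = δ (b a)` in both orders gives `(σ b - b) δ a = (σ a - a) δ b`.
    rw [mul_comm b a, h1] at h2
    have := sub_ne_zero.mpr hb
    field_simp
    linear_combination -h2
  · push Not at h
    refine ⟨0, fun a => ?_⟩
    -- Here `σ` is the identity and `δ` an ordinary derivation, so applying it to `a ^ |F| = a`
    -- gives `δ a = 0` in this characteristic.
    have hpow : ∀ n : ℕ, δ (a ^ (n + 1)) = (n + 1 : ℕ) * a ^ n * δ a := by
      intro n
      induction n with
      | zero => simp
      | succ n ih =>
        have h1 : δ (a ^ (n + 1) * a) = σ (a ^ (n + 1)) * δ a + δ (a ^ (n + 1)) * a :=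
          δ.leibniz' _ _
        rw [pow_succ a (n + 1), h1, ih, h]
        push_cast
        ring
    have := Fintype.ofFinite F
    obtain ⟨n, hn⟩ := Nat.exists_eq_succ_of_ne_zero (Fintype.card_ne_zero (α := F))
    have h1 := hpow n
    rw [← Nat.succ_eq_add_one, ← hn, FiniteField.pow_card, FiniteField.cast_card_eq_zero, zero_mul,
      zero_mul] at h1
    rw [h1, zero_mul]

/-- The inner `σ`-derivation `a ↦ c (σ a - a)`. -/
def innerDerivation {K : Type*} [Field K] (σ : K →+* K) (c : K) : SkewDerivation σ where
  toFun a := c * (σ a - a)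
  map_zero' := by simp
  map_add' a b := by rw [map_add]; ring
  leibniz' a b := by rw [map_mul]; ring

end InnerDerivation

/-! ### Left roots over an algebraically closed field. -/

section Root

variable {K : Type*} [Field K] {σ : K →+* K} {δ : SkewDerivation σ}

/-- The power `yⁱ` is monic of degree `i`, and `σⁱ` is surjective, so leading terms can be removed
successively by `yⁱ` times a constant on the right. -/
theorem exists_eq_sum_pow_mul_C (hσ : Function.Surjective σ) {y : OreExtension σ δ}
    (hy : ∀ k, 1 < k → y.coeff k = 0) (hy1 : y.coeff 1 = 1) (N : ℕ) (D : OreExtension σ δ)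
    (hD : ∀ k, N ≤ k → D.coeff k = 0) :
    ∃ A : ℕ → K, D = ∑ i ∈ Finset.range N, y ^ i * C σ δ (A i) := by
  have hpow : ∀ i, (∀ k, i < k → (y ^ i).coeff k = 0) ∧ (y ^ i).coeff i = 1 := by
    intro i
    induction i with
    | zero => exact ⟨fun k hk => by rw [pow_zero, coeff_one, if_neg hk.ne'], by simp [coeff_one]⟩
    | succ i ih =>
      rw [pow_succ]
      refine ⟨fun k hk => coeff_mul_of_lt ih.1 hy hk, ?_⟩
      rw [coeff_mul_top ih.1 hy, ih.2, hy1, ← RingHom.coe_pow, map_one, one_mul]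
  induction N generalizing D with
  | zero => exact ⟨0, by ext k; simp [hD k]⟩
  | succ N ih =>
    obtain ⟨a, ha⟩ := hσ.iterate N (D.coeff N)
    have hC : ∀ k, 0 < k → (C σ δ a).coeff k = 0 := fun k hk => by rw [coeff_C, if_neg hk.ne']
    obtain ⟨A, hA⟩ := ih (D - y ^ N * C σ δ a) fun k hk => by
      rw [coeff_sub]
      rcases hk.lt_or_eq with hk | rfl
      · rw [hD k hk, coeff_mul_of_lt (hpow N).1 hC hk, sub_zero]
      · have := coeff_mul_top (hpow N).1 hC
        rw [add_zero, (hpow N).2, one_mul, coeff_C, if_pos rfl, ha] at this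
        rw [this, sub_self]
    refine ⟨Function.update A N a, ?_⟩
    rw [Finset.sum_range_succ, Function.update_self, ← sub_eq_iff_eq_add, hA]
    refine Finset.sum_congr rfl fun i hi => ?_
    rw [Function.update_of_ne (Finset.mem_range.mp hi).ne]

/-- Over an algebraically closed field with `σ` the power map of exponent `Q` and `δ` inner,
every skew polynomial of positive degree has a left root. -/
theorem exists_isLeftRoot [IsAlgClosed K] (hσ : Function.Surjective σ) {Q : ℕ} (hQ : 0 < Q)
    (hσQ : ∀ a, σ a = a ^ Q) {c : K} (hδ : ∀ a, δ a = c * (σ a - a)) {D : OreExtension σ δ}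
    (hD : 0 < D.natDegree) : ∃ a, IsLeftRoot a D := by
  -- The shift by `c` absorbs the inner derivation: `y a = σ(a) y`.
  set y : OreExtension σ δ := X σ δ + C σ δ c with hy
  have hyC : ∀ a, y * C σ δ a = C σ δ (σ a) * y := fun a => by
    rw [hy, add_mul, X_mul_C, mul_add, C_mul_C, C_mul_C, add_assoc, ← C_add, hδ]
    congr 2
    ring
  set N := D.natDegree with hN
  obtain ⟨A, hA⟩ := exists_eq_sum_pow_mul_C (y := y) hσ
    (fun k hk => by
      rw [hy, coeff_add, coeff_X, coeff_C, if_neg hk.ne, if_neg (by omega), add_zero])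
    (by rw [hy, coeff_add, coeff_X, coeff_C]; simp) (N + 1) D
    (fun k hk => coeff_eq_zero_of_natDegree_lt hk)
  -- On left division by `y - β`, the remainder of `yⁱ` is the product of `σ⁻ʲ(β)` over `j < i`.
  -- Taking `β = b ^ Q ^ N` clears the `Q`-th roots for `i ≤ N + 1` and gives `b ^ e i`. Thus `P`
  -- evaluated at `b` is the remainder of `D`.
  let e : ℕ → ℕ := fun i => ∑ j ∈ Finset.range i, Q ^ (N - j)
  have he : StrictMono e := strictMono_nat_of_lt_succ fun i => by
    simp only [e, Finset.sum_range_succ]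
    exact Nat.lt_add_of_pos_right (pow_pos hQ _)
  let P : Polynomial K := ∑ i ∈ Finset.range (N + 1), Polynomial.monomial (e i) (A i)
  have hcoeff : ∀ i < N + 1, P.coeff (e i) = A i := fun i hi => by
    simp only [P, Polynomial.finsetSum_coeff, Polynomial.coeff_monomial, he.injective.eq_iff,
      Finset.sum_ite_eq', Finset.mem_range, if_pos hi]
  -- The exponents `e i` are distinct, so a constant nonzero `P` would leave only `A 0` and make `D`
  -- constant.
  have hP : P.degree ≠ 0 := fun h0 => by
    have hA0 : ∀ i < N, A (i + 1) = 0 := fun i hi => by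
      rw [← hcoeff (i + 1) (by omega)]
      refine Polynomial.coeff_eq_zero_of_degree_lt ?_
      rw [h0]
      exact_mod_cast (Nat.zero_le _).trans_lt (he i.succ_pos)
    rw [Finset.sum_range_succ', Finset.sum_eq_zero fun i hi => by
      rw [hA0 i (Finset.mem_range.mp hi), C_zero, mul_zero], pow_zero, one_mul, zero_add] at hA
    rw [hN, hA, natDegree_C] at hD
    exact lt_irrefl 0 hD
  obtain ⟨b, hb⟩ := IsAlgClosed.exists_root P hP
  have hrem : ∀ i, i ≤ N + 1 →
      ∃ h, y ^ i = (y - C σ δ (b ^ Q ^ N)) * h + C σ δ (b ^ e i) := by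
    intro i
    induction i with
    | zero => exact fun _ => ⟨0, by simp [e, C_one]⟩
    | succ i ih =>
      intro hi
      obtain ⟨h, hh⟩ := ih (by omega)
      set e' := ∑ j ∈ Finset.range i, Q ^ (N - (j + 1)) with he'
      -- Lowering every exponent of `Q` by one inverts `σ`; none is truncated, since `i ≤ N`.
      have h1 : σ (b ^ e') = b ^ e i := by
        rw [hσQ, ← pow_mul, he', Finset.sum_mul]
        congr 1
        refine Finset.sum_congr rfl fun j hj => ?_
        have := Finset.mem_range.mp hj
        rw [← pow_succ]
        congr 1
        omega
      have h2 : e (i + 1) = Q ^ N + e' := by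
        simp only [e, Finset.sum_range_succ', he', Nat.sub_zero, add_comm]
      refine ⟨h * y + C σ δ (b ^ e'), ?_⟩
      rw [pow_succ, hh, add_mul, ← h1, ← hyC, h2, pow_add, ← C_mul_C]
      noncomm_ring
  choose! h hh using hrem
  refine ⟨b ^ Q ^ N - c, ∑ i ∈ Finset.range (N + 1), h i * C σ δ (A i), ?_⟩
  have hyX : X σ δ - C σ δ (b ^ Q ^ N - c) = y - C σ δ (b ^ Q ^ N) := by
    rw [C_sub, hy]
    abel
  have hb' : ∑ i ∈ Finset.range (N + 1), C σ δ (b ^ e i) * C σ δ (A i) = 0 := by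
    simp only [C_mul_C, ← C_sum]
    rw [← C_zero, ← hb]
    simp [P, Polynomial.eval_finsetSum, mul_comm]
  rw [hyX, Finset.mul_sum]
  nth_rw 1 [hA]
  rw [← add_zero (∑ i ∈ Finset.range (N + 1), (y - _) * _), ← hb', ← Finset.sum_add_distrib]
  refine Finset.sum_congr rfl fun i hi => ?_
  rw [hh i (by have := Finset.mem_range.mp hi; omega), add_mul, mul_assoc]

end Root

/-- A finite field with a skew derivation extends to an algebraically closed field, with an
automorphism, over which all skew polynomials of positive degree have left roots. -/
theorem exists_extension_forall_isLeftRoot {F : Type u} [Field F] [Finite F] (σ : F →+* F)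
    (δ : SkewDerivation σ) :
    ∃ (K : Type v) (_ : Field K) (ι : F →+* K) (σ' : K →+* K) (δ' : SkewDerivation σ'),
      IsPolynomialRingExtension σ δ ι σ' δ' ∧ Function.Bijective σ' ∧
      ∀ D : OreExtension σ' δ', 0 < D.natDegree → ∃ a, IsLeftRoot a D := by
  obtain ⟨p, hchar⟩ := CharP.exists F
  have hp : Fact p.Prime := ⟨CharP.char_is_prime F p⟩
  let _ : Algebra (ZMod p) F := ZMod.algebra F p
  -- Lifting the prime field places its algebraic closure in the required universe.
  let K := AlgebraicClosure (ULift.{v} (ZMod p))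
  have : CharP K p := charP_of_injective_algebraMap
    (algebraMap (ULift.{v} (ZMod p)) K).injective p
  let _ : Algebra (ZMod p) K := ZMod.algebra K p
  let ι : F →+* K := (IsAlgClosed.lift : F →ₐ[ZMod p] K)
  -- Every endomorphism of `F` fixes the prime field, hence is a power of Frobenius; the same power
  -- defines `σ'` on `K`.
  obtain ⟨n, hn⟩ := (FiniteField.bijective_frobeniusAlgHom_pow (ZMod p) F).2
    { σ with
      commutes' := RingHom.congr_fun
        (Subsingleton.elim (σ.comp (algebraMap (ZMod p) F)) (algebraMap (ZMod p) F)) }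
  have hσ : ∀ a, σ a = a ^ p ^ (n : ℕ) := fun a => by
    have := DFunLike.congr_fun hn a
    simp only [AlgHom.coe_pow, FiniteField.coe_frobeniusAlgHom, pow_iterate, ZMod.card] at this
    exact this.symm
  obtain ⟨c, hc⟩ := exists_inner δ
  let σ' : K →+* K := iterateFrobenius K p n
  have hσ' : ∀ a, σ' a = a ^ p ^ (n : ℕ) := fun a => rfl
  have hbij : Function.Bijective σ' := bijective_iterateFrobenius K p n
  have hsig : ∀ a, σ' (ι a) = ι (σ a) := fun a => by rw [hσ', hσ, map_pow]
  refine ⟨K, inferInstance, ι, σ', innerDerivation σ' (ι c), ⟨hsig, fun a => ?_⟩, hbij,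
    fun D hD => exists_isLeftRoot hbij.2 (pow_pos hp.out.pos n) hσ' (fun _ => rfl) hD⟩
  rw [hc, map_mul, map_sub, ← hsig]
  rfl

end OreExtension

/-! ### The equivalence. -/

open OreExtension in
theorem theorem3p41 {F : Type u} [Field F] [Finite F] (σ : F →+* F) (δ : SkewDerivation σ)
    (f g : OreExtension σ δ) (hf : 0 < f.natDegree) (hg : 0 < g.natDegree) :
    (∃ (K : Type v) (_ : DivisionRing K) (ι : F →+* K) (σ' : K →+* K) (δ' : SkewDerivation σ'),
        OreExtension.IsPolynomialRingExtension σ δ ι σ' δ' ∧ Function.Bijective σ' ∧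
        ∃ a : K, OreExtension.IsLeftRoot a (OreExtension.mapCoeff ι σ' δ' f) ∧
          OreExtension.IsLeftRoot a (OreExtension.mapCoeff ι σ' δ' g)) ↔
      OreExtension.leftResultant (OreExtension.bijective_of_finite σ) f g = 0 := by
  constructor
  · rintro ⟨K, _, ι, σ', δ', hext, -, a, ⟨f', hf'⟩, ⟨g', hg'⟩⟩
    by_contra hR
    obtain ⟨u, v, huv⟩ := exists_mul_add_mul_eq_one (bijective_of_finite σ) g hf hR
    have h1 := congrArg (mapCoeff ι σ' δ') huv
    rw [map_add, hext.mapCoeff_mul, hext.mapCoeff_mul, hf', hg', mul_assoc, mul_assoc, ← mul_add,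
      ← C_one, mapCoeff_C, map_one] at h1
    set y := X σ' δ' - C σ' δ' a with hy
    set q := f' * mapCoeff ι σ' δ' u + g' * mapCoeff ι σ' δ' v
    have hone : C σ' δ' (1 : K) ≠ 0 := fun h => by
      have := congrArg (fun p => coeff p 0) h
      simp [coeff_C] at this
    have hy1 : y.coeff 1 = 1 := by simp [hy, coeff_X, coeff_C]
    have hy0 : y ≠ 0 := left_ne_zero_of_mul (h1 ▸ hone)
    -- The identity is now `(x - a) q = 1`, whose left side has degree at least one.
    have hd := congrArg natDegree h1
    rw [natDegree_mul hy0 (right_ne_zero_of_mul (h1 ▸ hone)), natDegree_C] at hd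
    have := le_natDegree (p := y) (i := 1) (by rw [hy1]; exact one_ne_zero)
    omega
  · intro hR
    obtain ⟨d, f', g', hd, rfl, rfl⟩ :=
      exists_common_left_factor_of_leftResultant_eq_zero (bijective_of_finite σ) hg hR
    obtain ⟨K, _, ι, σ', δ', hext, hbij, hroot⟩ := exists_extension_forall_isLeftRoot.{u, v} σ δ
    obtain ⟨a, q, hq⟩ := hroot (mapCoeff ι σ' δ' d) (by rwa [natDegree_mapCoeff])
    refine ⟨K, inferInstance, ι, σ', δ', hext, hbij, a, ?_, ?_⟩
    · exact ⟨q * mapCoeff ι σ' δ' f', by rw [hext.mapCoeff_mul, hq, mul_assoc]⟩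
    · exact ⟨q * mapCoeff ι σ' δ' g', by rw [hext.mapCoeff_mul, hq, mul_assoc]⟩
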